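/- Let $\sigma_1>0$ and let $y_0,y_1,y_2,\dots$ be independent random variables, each with law $\mathcal N(0,\sigma_1^2)$ (hypothesis $\mathcal H_1$: only the legitimate user is present). For $N\ge 1$ put $\mathbf y=(y_0,\dots,y_{N-1})$ and $Y=\sum_{n=0}^{N-1}y_n^2$, and for $\sigma^2>0$ let $$p(\mathbf y;\sigma^2)=\prod_{n=0}^{N-1}\frac{1}{\sqrt{2\pi\sigma^2}}\,e^{-y_n^2/(2\sigma^2)}$$ be the Gaussian likelihood. Then, almost surely, for every $N\ge1$ the number $\hat\sigma_2^2=Y/N$ is positive and is the unique maximizer of $\sigma^2\mapsto p(\mathbf y;\sigma^2)$ over $(0,\infty)$, i.e. the maximum likelihood estimate of the variance. Moreover, for the generalized likelihood ratio $$L_1=\frac{p(\mathbf y;\hat\sigma_2^2)}{p(\mathbf y;\sigma_1^2)},$$ the random variables $2\ln L_1$ converge in distribution, as $N\to\infty$, to the chi-squared distribution $\chi^2_1$ with one degree of freedom (the law of $Z^2$ for $Z\sim\mathcal N(0,1)$). -/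

import Mathlib

open MeasureTheory ProbabilityTheory Filter
open scoped NNReal

namespace SpectrumSensing

noncomputable section

/-- The likelihood `p(y; v)` of a sample `y = (y_0, …, y_{N-1})`: the joint density at `y` of `N`
independent centered Gaussian variables with variance `v`. -/
def likelihood {N : ℕ} (y : Fin N → ℝ) (v : ℝ≥0) : ℝ :=
  ∏ i, gaussianPDFReal 0 v (y i)

/-- The test statistic `Y = ∑ y_n ^ 2`. -/
def energy {N : ℕ} (y : Fin N → ℝ) : ℝ := ∑ i, y i ^ 2

/-- The variance estimate `Y / N`. -/
def varianceEstimate {N : ℕ} (y : Fin N → ℝ) : ℝ≥0 := (energy y / N).toNNReal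

/-- `v` is the (unique) maximum likelihood estimate of the unknown variance from the sample `y`:
the strict global maximizer of the likelihood over all positive variances. -/
def IsMLE {N : ℕ} (y : Fin N → ℝ) (v : ℝ≥0) : Prop :=
  0 < v ∧ ∀ w : ℝ≥0, 0 < w → w ≠ v → likelihood y w < likelihood y v

/-- The generalized likelihood ratio for testing the variance `v₁` against an unknown
variance, with the unknown variance replaced by its estimate `Y / N`. -/
def glr (v₁ : ℝ≥0) {N : ℕ} (y : Fin N → ℝ) : ℝ :=
  likelihood y (varianceEstimate y) / likelihood y v₁

/-- The chi-squared distribution with `k` degrees of freedom: the law of the sum of the squares of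
`k` independent standard Gaussian variables. -/
def chiSquared (k : ℕ) : Measure ℝ :=
  (Measure.pi fun _ : Fin k ↦ gaussianReal 0 1).map fun z ↦ ∑ i, z i ^ 2

instance isProbabilityMeasure_chiSquared (k : ℕ) : IsProbabilityMeasure (chiSquared k) :=
  Measure.isProbabilityMeasure_map
    (Measurable.aemeasurable (by fun_prop))

end

end SpectrumSensing

open scoped Topology

namespace SpectrumSensing

/-! Write r for the variance estimate divided by a variance w. The log-likelihood gap between the
estimate and w is (N/2)(r - 1 - log r), which is positive unless r = 1 because log r < r - 1: this
is the maximum likelihood claim. For w = σ₁², 2 log L₁ = N (r - 1)² h(r), where h is `logRemainder`,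
continuous at 1 with value 1/2. The strong law gives r → 1 almost surely, so h(r) → 1/2 in
probability; the central limit theorem gives √N (r - 1)/√2 → Z in law. Slutsky's theorem combines
them into the limit Z². -/

lemma likelihood_pos {N : ℕ} (y : Fin N → ℝ) {v : ℝ≥0} (hv : 0 < v) : 0 < likelihood y v :=
  Finset.prod_pos fun _ _ ↦ gaussianPDFReal_pos _ _ _ hv.ne'

lemma log_gaussianPDFReal_zero {v : ℝ≥0} (hv : 0 < v) (x : ℝ) :
    Real.log (gaussianPDFReal 0 v x) =
      -(Real.log (2 * Real.pi) + Real.log v) / 2 - x ^ 2 / (2 * v) := by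
  have hv' : (0 : ℝ) < v := hv
  rw [gaussianPDFReal_def, Real.log_mul (by positivity) (by positivity), Real.log_inv,
    Real.log_sqrt (by positivity), Real.log_mul (by positivity) hv'.ne', Real.log_exp]
  ring

lemma log_likelihood {N : ℕ} (y : Fin N → ℝ) {v : ℝ≥0} (hv : 0 < v) :
    Real.log (likelihood y v) =
      -(N * (Real.log (2 * Real.pi) + Real.log v)) / 2 - energy y / (2 * v) := by
  rw [likelihood, Real.log_prod fun _ _ ↦ (gaussianPDFReal_pos _ _ _ hv.ne').ne']
  simp only [log_gaussianPDFReal_zero hv, Finset.sum_sub_distrib, Finset.sum_const,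
    Finset.card_univ, Fintype.card_fin, nsmul_eq_mul, energy, Finset.sum_div]
  ring

lemma energy_nonneg {N : ℕ} (y : Fin N → ℝ) : 0 ≤ energy y :=
  Finset.sum_nonneg fun _ _ ↦ sq_nonneg _

lemma coe_varianceEstimate {N : ℕ} (y : Fin N → ℝ) :
    (varianceEstimate y : ℝ) = energy y / N :=
  Real.coe_toNNReal _ (div_nonneg (energy_nonneg y) N.cast_nonneg)

lemma varianceEstimate_pos {N : ℕ} (hN : 1 ≤ N) (y : Fin N → ℝ) (hy : ∀ i, y i ≠ 0) :
    0 < varianceEstimate y := by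
  have : Nonempty (Fin N) := ⟨⟨0, hN⟩⟩
  refine Real.toNNReal_pos.2 (div_pos ?_ (by exact_mod_cast hN))
  exact Finset.sum_pos (fun i _ ↦ by have := hy i; positivity) Finset.univ_nonempty

lemma log_likelihood_varianceEstimate_sub {N : ℕ} (hN : 1 ≤ N) (y : Fin N → ℝ)
    (hy : 0 < varianceEstimate y) {w : ℝ≥0} (hw : 0 < w) :
    Real.log (likelihood y (varianceEstimate y)) - Real.log (likelihood y w) =
      N / 2 * ((varianceEstimate y : ℝ) / w - 1 - Real.log ((varianceEstimate y : ℝ) / w)) := by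
  have hv' : (0 : ℝ) < varianceEstimate y := hy
  have hw' : (0 : ℝ) < w := hw
  have hN' : (0 : ℝ) < N := by exact_mod_cast hN
  have hE : energy y = N * varianceEstimate y := by rw [coe_varianceEstimate]; field_simp
  rw [log_likelihood y hy, log_likelihood y hw, Real.log_div hv'.ne' hw'.ne', hE]
  field_simp
  ring

lemma isMLE_varianceEstimate {N : ℕ} (hN : 1 ≤ N) (y : Fin N → ℝ)
    (hy : 0 < varianceEstimate y) : IsMLE y (varianceEstimate y) := by
  refine ⟨hy, fun w hw hne ↦ ?_⟩
  have hv' : (0 : ℝ) < varianceEstimate y := hy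
  have hw' : (0 : ℝ) < w := hw
  have hN' : (0 : ℝ) < N := by exact_mod_cast hN
  rw [← Real.log_lt_log_iff (likelihood_pos y hw) (likelihood_pos y hy), ← sub_pos,
    log_likelihood_varianceEstimate_sub hN y hy hw]
  refine mul_pos (by positivity) (sub_pos.2 (Real.log_lt_sub_one_of_pos (by positivity) ?_))
  rw [Ne, div_eq_one_iff_eq hw'.ne']
  exact fun h ↦ hne (NNReal.coe_injective h.symm)

lemma two_mul_log_glr {N : ℕ} (y : Fin N → ℝ) (hy : ∀ i, y i ≠ 0) {w : ℝ≥0} (hw : 0 < w) :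
    2 * Real.log (glr w y) =
      N * ((varianceEstimate y : ℝ) / w - 1 - Real.log ((varianceEstimate y : ℝ) / w)) := by
  rcases Nat.eq_zero_or_pos N with rfl | hN
  · simp [glr, likelihood]
  have hv := varianceEstimate_pos hN y hy
  rw [glr, Real.log_div (likelihood_pos y hv).ne' (likelihood_pos y hw).ne',
    log_likelihood_varianceEstimate_sub hN y hv hw]
  ring

/-- The second order remainder quotient of `Real.log` at `1`, extended continuously to `1`. -/
noncomputable def logRemainder (r : ℝ) : ℝ :=
  if r = 1 then 1 / 2 else (r - 1 - Real.log r) / (r - 1) ^ 2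

lemma sub_one_sq_mul_logRemainder (r : ℝ) :
    (r - 1) ^ 2 * logRemainder r = r - 1 - Real.log r := by
  by_cases h : r = 1
  · simp [h]
  · have : r - 1 ≠ 0 := sub_ne_zero.2 h
    rw [logRemainder, if_neg h]
    field_simp

lemma measurable_logRemainder : Measurable logRemainder :=
  Measurable.ite (measurableSet_singleton 1) measurable_const (by fun_prop)

/-- With x = 1 - r, the series of log(1 - x) cut after x² has error at most |x|³/(1 - |x|); dividing
by x² gives the bound. -/
lemma abs_logRemainder_sub_half_le {r : ℝ} (hr : |1 - r| < 1) :
    |logRemainder r - 1 / 2| ≤ |1 - r| / (1 - |1 - r|) := by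
  by_cases h : r = 1
  · simp [h, logRemainder]
  have h0 : 0 < |1 - r| := abs_pos.2 (sub_ne_zero.2 (Ne.symm h))
  have key := Real.abs_log_sub_add_sum_range_le hr 2
  have e : (∑ i ∈ Finset.range 2, (1 - r) ^ (i + 1) / ((i : ℝ) + 1)) + Real.log (1 - (1 - r)) =
      -((1 - r) ^ 2 * (logRemainder r - 1 / 2)) := by
    have := sub_one_sq_mul_logRemainder r
    simp only [Finset.sum_range_succ, Finset.sum_range_zero]
    rw [sub_sub_cancel]
    push_cast
    linear_combination this
  rw [e, abs_neg, abs_mul, abs_pow] at key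
  refine le_of_mul_le_mul_left (key.trans_eq ?_) (pow_pos h0 2)
  ring

lemma continuousAt_logRemainder : ContinuousAt logRemainder 1 := by
  rw [ContinuousAt, show logRemainder 1 = 1 / 2 by simp [logRemainder],
    tendsto_iff_norm_sub_tendsto_zero]
  have hc : Tendsto (fun r : ℝ ↦ |1 - r| / (1 - |1 - r|)) (𝓝 1) (𝓝 0) := by
    have : ContinuousAt (fun r : ℝ ↦ |1 - r| / (1 - |1 - r|)) 1 :=
      ContinuousAt.div (by fun_prop) (by fun_prop) (by simp)
    simpa [ContinuousAt] using this
  refine squeeze_zero' (.of_forall fun _ ↦ norm_nonneg _) ?_ hc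
  filter_upwards [Metric.ball_mem_nhds (1 : ℝ) one_pos] with r hr
  refine abs_logRemainder_sub_half_le ?_
  rwa [Metric.mem_ball', Real.dist_eq] at hr

/-! ### Moments of the standard Gaussian -/

lemma integral_sq_gaussianReal : ∫ x, x ^ 2 ∂gaussianReal 0 1 = 1 := by
  have := variance_fun_id_gaussianReal (μ := 0) (v := 1)
  rw [variance_eq_integral (by fun_prop)] at this
  simpa [integral_id_gaussianReal] using this

/-- Evenness reduces the integral to a half-line, where it is a multiple of Γ(5/2). It makes the
variance of x² equal to 3 - 1 = 2, hence the later normalization by √2. -/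
lemma integral_pow_four_gaussianReal : ∫ x, x ^ 4 ∂gaussianReal 0 1 = 3 := by
  rw [integral_gaussianReal_eq_integral_smul one_ne_zero]
  have h1 : ∀ x : ℝ, gaussianPDFReal 0 1 x • x ^ 4 =
      (√(2 * Real.pi))⁻¹ * (|x| ^ (4 : ℝ) * Real.exp (-(1 / 2) * |x| ^ (2 : ℝ))) := by
    intro x
    have h4 : |x| ^ (4 : ℝ) = x ^ 4 := by
      rw [show (4 : ℝ) = (4 : ℕ) by norm_num, Real.rpow_natCast, Even.pow_abs (by decide)]
    have h2 : |x| ^ (2 : ℝ) = x ^ 2 := by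
      rw [show (2 : ℝ) = (2 : ℕ) by norm_num, Real.rpow_natCast, sq_abs]
    rw [h4, h2, gaussianPDFReal_def, smul_eq_mul]
    simp only [NNReal.coe_one, sub_zero, mul_one]
    rw [show -x ^ 2 / 2 = -(1 / 2) * x ^ 2 by ring]
    ring
  have hG : Real.Gamma ((4 + 1) / 2) = 3 / 4 * √Real.pi := by
    rw [show ((4 : ℝ) + 1) / 2 = (1 / 2 + 1) + 1 by norm_num, Real.Gamma_add_one (by norm_num),
      Real.Gamma_add_one (by norm_num), Real.Gamma_one_half_eq]
    ring
  have hr : (1 / 2 : ℝ) ^ (-((4 : ℝ) + 1) / 2) = 4 * √2 := by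
    rw [one_div, Real.inv_rpow (by norm_num), ← Real.rpow_neg (by norm_num),
      show -(-((4 : ℝ) + 1) / 2) = (2 : ℕ) + 1 / 2 by norm_num, Real.rpow_add (by norm_num),
      Real.rpow_natCast, ← Real.sqrt_eq_rpow]
    norm_num
  simp_rw [h1]
  rw [integral_const_mul,
    integral_comp_abs (f := fun x ↦ x ^ (4 : ℝ) * Real.exp (-(1 / 2) * x ^ (2 : ℝ))),
    integral_rpow_mul_exp_neg_mul_rpow two_pos (by norm_num) (by norm_num), hG, hr,
    Real.sqrt_mul (by norm_num)]
  have : (0 : ℝ) < √Real.pi := Real.sqrt_pos.2 Real.pi_pos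
  field_simp

lemma integrable_pow_gaussianReal (n : ℕ) : Integrable (fun x ↦ x ^ n) (gaussianReal 0 1) :=
  integrable_pow_of_mem_interior_integrableExpSet (X := id) (by simp) n

lemma integral_standardized_sq_gaussianReal :
    ∫ x, (x ^ 2 - 1) / √2 ∂gaussianReal 0 1 = 0 := by
  rw [integral_div, integral_sub (integrable_pow_gaussianReal 2) (integrable_const 1),
    integral_sq_gaussianReal]
  simp

lemma integral_standardized_sq_sq_gaussianReal :
    ∫ x, ((x ^ 2 - 1) / √2) ^ 2 ∂gaussianReal 0 1 = 1 := by
  have : ∀ x : ℝ, ((x ^ 2 - 1) / √2) ^ 2 = (x ^ 4 - 2 * x ^ 2 + 1) / 2 := fun x ↦ by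
    rw [div_pow, Real.sq_sqrt (by norm_num)]; ring
  simp_rw [this]
  have h2 := (integrable_pow_gaussianReal 2).const_mul 2
  rw [integral_div, integral_add (f := fun x ↦ x ^ 4 - 2 * x ^ 2)
      ((integrable_pow_gaussianReal 4).sub h2) (integrable_const 1),
    integral_sub (integrable_pow_gaussianReal 4) h2, integral_const_mul,
    integral_sq_gaussianReal, integral_pow_four_gaussianReal]
  norm_num

/-! ### Limit theorems for the normalized energy -/

section

variable {Ω : Type*} [MeasurableSpace Ω] {P : Measure Ω} {u : ℕ → Ω → ℝ}

lemma ae_tendsto_energy_div (hlaw : ∀ n, HasLaw (u n) (gaussianReal 0 1) P)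
    (hindep : iIndepFun u P) :
    ∀ᵐ ω ∂P, Tendsto (fun N : ℕ ↦ (∑ k ∈ Finset.range N, u k ω ^ 2) / N) atTop (𝓝 1) := by
  have hm : Measurable fun x : ℝ ↦ x ^ 2 := by fun_prop
  have hmean : P[fun ω ↦ u 0 ω ^ 2] = 1 := by
    refine Eq.trans ?_ integral_sq_gaussianReal
    exact (hlaw 0).integral_comp (f := fun x ↦ x ^ 2) hm.aestronglyMeasurable
  rw [← hmean]
  refine strong_law_ae_real (fun k ω ↦ u k ω ^ 2) ?_
    (fun i j hij ↦ (hindep.indepFun hij).comp hm hm)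
    fun i ↦ ((hlaw i).identDistrib (hlaw 0)).comp hm
  -- A non-integrable function has integral 0 by convention, but this mean is 1.
  by_contra h
  exact one_ne_zero (hmean.symm.trans (integral_undef h))

variable [IsProbabilityMeasure P]

/-- Z is realized on `Fin 1 → ℝ` so that the law of Z² is `chiSquared 1` almost by definition. -/
lemma hasLaw_eval_pi_gaussianReal :
    HasLaw (fun z : Fin 1 → ℝ ↦ z 0) (gaussianReal 0 1) (Measure.pi fun _ ↦ gaussianReal 0 1) :=
  ⟨(measurable_pi_apply 0).aemeasurable,
    (measurePreserving_eval (fun _ : Fin 1 ↦ gaussianReal 0 1) 0).map_eq⟩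

lemma tendstoInDistribution_standardized_energy (hlaw : ∀ n, HasLaw (u n) (gaussianReal 0 1) P)
    (hindep : iIndepFun u P) :
    TendstoInDistribution
      (fun (N : ℕ) ω ↦ (√N)⁻¹ * ∑ k ∈ Finset.range N, (u k ω ^ 2 - 1) / √2) atTop
      (fun z : Fin 1 → ℝ ↦ z 0) (fun _ ↦ P) (Measure.pi fun _ ↦ gaussianReal 0 1) := by
  have hm : Measurable fun x : ℝ ↦ (x ^ 2 - 1) / √2 := by fun_prop
  refine tendstoInDistribution_inv_sqrt_mul_sum (X := fun k ω ↦ (u k ω ^ 2 - 1) / √2)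
    hasLaw_eval_pi_gaussianReal ?_ ?_ (hindep.comp _ fun _ ↦ hm)
    fun i ↦ ((hlaw i).identDistrib (hlaw 0)).comp hm
  · refine Eq.trans ?_ integral_standardized_sq_gaussianReal
    exact (hlaw 0).integral_comp (f := fun x ↦ (x ^ 2 - 1) / √2) hm.aestronglyMeasurable
  · refine Eq.trans ?_ integral_standardized_sq_sq_gaussianReal
    exact (hlaw 0).integral_comp (f := fun x ↦ ((x ^ 2 - 1) / √2) ^ 2)
      (hm.pow_const 2).aestronglyMeasurable

lemma tendstoInDistribution_mul_sub_one_sub_log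
    (hlaw : ∀ n, HasLaw (u n) (gaussianReal 0 1) P) (hindep : iIndepFun u P) :
    TendstoInDistribution
      (fun (N : ℕ) ω ↦ N * ((∑ k ∈ Finset.range N, u k ω ^ 2) / N - 1
        - Real.log ((∑ k ∈ Finset.range N, u k ω ^ 2) / N))) atTop
      (fun z : Fin 1 → ℝ ↦ z 0 ^ 2) (fun _ ↦ P) (Measure.pi fun _ ↦ gaussianReal 0 1) := by
  have hu n : AEMeasurable (u n) P := (hlaw n).aemeasurable
  have hm (N : ℕ) : AEMeasurable
      (fun ω ↦ logRemainder ((∑ k ∈ Finset.range N, u k ω ^ 2) / N)) P :=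
    measurable_logRemainder.comp_aemeasurable
      ((Finset.aemeasurable_fun_sum _ fun k _ ↦ (hu k).pow_const 2).div_const _)
  have hprob : TendstoInMeasure P
      (fun (N : ℕ) ω ↦ logRemainder ((∑ k ∈ Finset.range N, u k ω ^ 2) / N)) atTop
      (fun _ ↦ 1 / 2) := by
    refine tendstoInMeasure_of_tendsto_ae (fun N ↦ (hm N).aestronglyMeasurable) ?_
    filter_upwards [ae_tendsto_energy_div hlaw hindep] with ω hω
    have := continuousAt_logRemainder.tendsto.comp hω
    rwa [show logRemainder 1 = 1 / 2 by simp [logRemainder]] at this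
  -- Slutsky: N (r - 1)² is twice the square of the standardized sum, whence the factor 2, which
  -- cancels the limit 1/2 of h(r).
  have key := (tendstoInDistribution_standardized_energy hlaw
    hindep).continuous_comp_prodMk_of_tendstoInMeasure_const
      (g := fun p : ℝ × ℝ ↦ p.1 ^ 2 * (2 * p.2)) (by fun_prop) hprob hm
  refine key.congr (fun N ↦ .of_forall fun ω ↦ ?_) (.of_forall fun z ↦ by simp)
  simp only [← sub_one_sq_mul_logRemainder]
  rcases Nat.eq_zero_or_pos N with rfl | hN
  · simp
  have hN' : (0 : ℝ) < N := by exact_mod_cast hN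
  have hs : √(N : ℝ) ^ 2 = N := Real.sq_sqrt hN'.le
  have h2 : √(2 : ℝ) ^ 2 = 2 := Real.sq_sqrt (by norm_num)
  simp only [← Finset.sum_div, Finset.sum_sub_distrib, Finset.sum_const, Finset.card_range,
    nsmul_eq_mul, mul_one, mul_pow, div_pow, inv_pow, hs, h2]
  field_simp

end

lemma TendstoInDistribution.of_map_eq {Ω Ω' : Type*} [MeasurableSpace Ω] [MeasurableSpace Ω']
    {P : Measure Ω} [IsProbabilityMeasure P] {Q : Measure Ω'} [IsProbabilityMeasure Q]
    {X : ℕ → Ω → ℝ} {Z : Ω' → ℝ} {μ : Measure ℝ} [IsProbabilityMeasure μ]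
    (h : TendstoInDistribution X atTop Z (fun _ ↦ P) Q) (hZ : Q.map Z = μ) :
    TendstoInDistribution X atTop (id : ℝ → ℝ) (fun _ ↦ P) μ where
  forall_aemeasurable := h.forall_aemeasurable
  tendsto := by
    subst hZ
    simpa only [Measure.map_id] using h.tendsto

end SpectrumSensing

theorem proposition1 {Ω : Type*} [MeasurableSpace Ω] (P : Measure Ω) [IsProbabilityMeasure P]
    (σ₁ : ℝ≥0) (hσ₁ : 0 < σ₁) (y : ℕ → Ω → ℝ)
    (hlaw : ∀ n, HasLaw (y n) (gaussianReal 0 (σ₁ ^ 2)) P) (hindep : iIndepFun y P) :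
    (∀ᵐ ω ∂P, ∀ N : ℕ, 1 ≤ N →
      SpectrumSensing.IsMLE (fun i : Fin N ↦ y i ω)
        (SpectrumSensing.varianceEstimate (fun i : Fin N ↦ y i ω))) ∧
    TendstoInDistribution
      (fun (N : ℕ) ω ↦ 2 * Real.log (SpectrumSensing.glr (σ₁ ^ 2) (fun i : Fin N ↦ y i ω)))
      atTop (id : ℝ → ℝ) (fun _ ↦ P) (SpectrumSensing.chiSquared 1) := by
  have hσ : (0 : ℝ) < σ₁ := hσ₁
  have hσ2 : 0 < σ₁ ^ 2 := pow_pos hσ₁ 2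
  -- A nondegenerate Gaussian has no atoms; nonzero samples keep the variance estimate positive.
  have hne : ∀ᵐ ω ∂P, ∀ n, y n ω ≠ 0 := by
    have := nullSingletonClass_gaussianReal (μ := 0) hσ2.ne'
    refine ae_all_iff.2 fun n ↦ ?_
    exact ae_of_ae_map (hlaw n).aemeasurable (by rw [(hlaw n).map_eq]; exact Measure.ae_ne _ 0)
  refine ⟨?_, ?_⟩
  · filter_upwards [hne] with ω hω N hN
    exact SpectrumSensing.isMLE_varianceEstimate hN _
      (SpectrumSensing.varianceEstimate_pos hN _ fun i ↦ hω i)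
  -- The ratio r depends only on the rescaled samples y n / σ₁, so the standard case suffices.
  have hlaw' (n : ℕ) : HasLaw (fun ω ↦ y n ω / σ₁) (gaussianReal 0 1) P := by
    convert! gaussianReal_div_const (hlaw n) σ₁ using 2
    · simp
    · ext
      simp [hσ.ne']
  have hindep' : iIndepFun (fun n ω ↦ y n ω / σ₁) P :=
    hindep.comp (fun _ x ↦ x / (σ₁ : ℝ)) fun _ ↦ by fun_prop
  have hchi : (Measure.pi fun _ : Fin 1 ↦ gaussianReal 0 1).map (fun z ↦ z 0 ^ 2) =
      SpectrumSensing.chiSquared 1 := by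
    simp [SpectrumSensing.chiSquared]
  refine SpectrumSensing.TendstoInDistribution.of_map_eq
    ((SpectrumSensing.tendstoInDistribution_mul_sub_one_sub_log hlaw' hindep').congr
      (fun N ↦ ?_) (.refl _ _)) hchi
  filter_upwards [hne] with ω hω
  have hr : (SpectrumSensing.varianceEstimate (fun i : Fin N ↦ y i ω) : ℝ) / (σ₁ ^ 2 : ℝ≥0) =
      (∑ k ∈ Finset.range N, (y k ω / σ₁) ^ 2) / N := by
    rw [SpectrumSensing.coe_varianceEstimate, SpectrumSensing.energy,
      Fin.sum_univ_eq_sum_range (fun k ↦ y k ω ^ 2)]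
    simp only [div_pow, ← Finset.sum_div]
    push_cast
    ring
  rw [SpectrumSensing.two_mul_log_glr _ (fun i ↦ hω i) hσ2, hr]
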